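/- Let $k$ be an algebraically closed field of arbitrary characteristic and let $R=k[x,y,z,w]$ be bigraded by $\deg x=\deg y=(1,0)$, $\deg z=\deg w=(0,1)$; write $R_{m,n}$ for the piece of degree $(m,n)$. Let $p_0,p_1,p_2\in R_{2,1}$ have no common zero on $\mathbb P^1\times\mathbb P^1$. Let $\mathrm{Syz}(p)=\{(A_0,A_1,A_2)\in R^3 : A_0p_0+A_1p_1+A_2p_2=0\}$, regarded as a graded submodule of $R(-2,-1)^3$, so that $\mathrm{Syz}(p)_{m,n}$ consists of the syzygies with all $A_i\in R_{m-2,n-1}$. In $\mathbb P^5=\mathbb P(R_{2,1})$ let $W(p)=\mathbb P(\mathrm{Span}(p_0,p_1,p_2))$, and let $Y$ be the image of the Segre embedding $\mathbb P^2\times\mathbb P^1=\mathbb P(R_{2,0})\times\mathbb P(R_{0,1})\to\mathbb P(R_{2,1})$ given by multiplication of polynomials. **Theorem 4.1.** (1) If $W(p)\cap Y$ is finite, then $\mathrm{Syz}(p)_{2,n}=0$ for all integers $n\ge 3$. (2) If $W(p)\cap Y$ is infinite, then $W(p)$ is a plane and $W(p)\cap Y$ is a smooth conic in it (that is, as a set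 of points it is the zero locus in $W(p)$ of a nonsingular quadratic form on $\mathrm{Span}(p_0,p_1,p_2)$), and $\dim_k \mathrm{Syz}(p)_{2,n}=n-2$ for all integers $n\ge 3$. Moreover there is $\sigma\in\mathrm{Syz}(p)_{2,3}$ such that for every $n\ge 3$ each element of $\mathrm{Syz}(p)_{2,n}$ equals $h\,\sigma$ for a unique $h\in R_{0,n-3}$. -/

import Mathlib

open scoped LinearAlgebra.Projectivization

/-- The polynomial ring `R = k[x, y, z, w]`, with variables `x, y, z, w` numbered `0, 1, 2, 3`. -/
abbrev BiRing (k : Type*) [Field k] : Type _ := MvPolynomial (Fin 4) k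

/-- The bidegrees of the variables: `x, y` have degree `(1, 0)` and `z, w` have degree `(0, 1)`. -/
def biWeight : Fin 4 → ℤ × ℤ := ![(1, 0), (1, 0), (0, 1), (0, 1)]

/-- The graded piece `R_{m,n}` of bihomogeneous polynomials of degree `(m, n)`, for `m, n ∈ ℤ`
(it is zero if `m < 0` or `n < 0`). -/
noncomputable def biPiece (k : Type*) [Field k] (m n : ℤ) : Submodule k (BiRing k) :=
  MvPolynomial.weightedHomogeneousSubmodule k biWeight (m, n)

/-- The polynomials `p₀, p₁, p₂` have no common zero on `ℙ¹ × ℙ¹`; points of `ℙ¹ × ℙ¹` are given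
by their bihomogeneous coordinates. -/
def NoCommonZero {k : Type*} [Field k] (p : Fin 3 → biPiece k 2 1) : Prop :=
  ∀ x y z w : k, (x ≠ 0 ∨ y ≠ 0) → (z ≠ 0 ∨ w ≠ 0) →
    ∃ i, MvPolynomial.eval ![x, y, z, w] (p i : BiRing k) ≠ 0

/-- The syzygy module `Syz(p) ⊆ R³` of all triples `A` with `A₀ p₀ + A₁ p₁ + A₂ p₂ = 0`. -/
noncomputable def biSyz {k : Type*} [Field k] (p : Fin 3 → biPiece k 2 1) :
    Submodule (BiRing k) (Fin 3 → BiRing k) :=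
  LinearMap.ker (Fintype.linearCombination (BiRing k) fun i => (p i : BiRing k))

/-- The graded piece `Syz(p)_{m,n}`. As `Syz(p)` is a graded submodule of `R(-2,-1)³`, it consists
of the syzygies whose three entries are bihomogeneous of degree `(m - 2, n - 1)`. -/
noncomputable def biSyzPiece {k : Type*} [Field k] (p : Fin 3 → biPiece k 2 1) (m n : ℤ) :
    Submodule k (Fin 3 → BiRing k) :=
  (biSyz p).restrictScalars k ⊓ Submodule.pi Set.univ fun _ => biPiece k (m - 2) (n - 1)

/-- The multiplication map `R_{2,0} × R_{0,1} → R_{2,1}`. -/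
noncomputable def segreMul {k : Type*} [Field k] (g : biPiece k 2 0) (h : biPiece k 0 1) : biPiece k 2 1 :=
  ⟨(g : BiRing k) * (h : BiRing k), by
    have hg : MvPolynomial.IsWeightedHomogeneous biWeight (g : BiRing k) ((2, 0) : ℤ × ℤ) := g.2
    have hh : MvPolynomial.IsWeightedHomogeneous biWeight (h : BiRing k) ((0, 1) : ℤ × ℤ) := h.2
    exact hg.mul hh⟩

theorem segreMul_ne_zero {k : Type*} [Field k] {g : biPiece k 2 0} {h : biPiece k 0 1}
    (hg : g ≠ 0) (hh : h ≠ 0) : segreMul g h ≠ 0 := by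
  intro h0
  have h1 : (g : BiRing k) * (h : BiRing k) = 0 := congrArg Subtype.val h0
  rcases mul_eq_zero.mp h1 with h2 | h2
  · exact hg (Subtype.ext h2)
  · exact hh (Subtype.ext h2)

/-- The Segre embedding `ℙ² × ℙ¹ = ℙ(R_{2,0}) × ℙ(R_{0,1}) → ℙ(R_{2,1}) = ℙ⁵` that is induced by
multiplication. It does not depend on the chosen representatives, see `segreMap_mk`. -/
noncomputable def segreMap (k : Type*) [Field k] (P : ℙ k (biPiece k 2 0) × ℙ k (biPiece k 0 1)) :
    ℙ k (biPiece k 2 1) :=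
  Projectivization.mk k (segreMul P.1.rep P.2.rep)
    (segreMul_ne_zero P.1.rep_nonzero P.2.rep_nonzero)

theorem segreMap_mk {k : Type*} [Field k] (g : biPiece k 2 0) (h : biPiece k 0 1)
    (hg : g ≠ 0) (hh : h ≠ 0) :
    segreMap k (Projectivization.mk k g hg, Projectivization.mk k h hh) =
      Projectivization.mk k (segreMul g h) (segreMul_ne_zero hg hh) := by
  obtain ⟨a, ha⟩ := Projectivization.exists_smul_eq_mk_rep k g hg
  obtain ⟨b, hb⟩ := Projectivization.exists_smul_eq_mk_rep k h hh
  unfold segreMap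
  rw [Projectivization.mk_eq_mk_iff]
  refine ⟨a * b, ?_⟩
  apply Subtype.ext
  simp only [← ha, ← hb, segreMul, Units.smul_def, Units.val_mul, Submodule.coe_smul,
    smul_mul_smul_comm]

/-- The Segre variety `Y ⊆ ℙ⁵`, as a set of points. -/
def segreY (k : Type*) [Field k] : Set (ℙ k (biPiece k 2 1)) :=
  Set.range (segreMap k)

/-- The linear subspace `ℙ(U) ⊆ ℙ(V)` of a vector subspace `U ⊆ V`, as a set of points. -/
def projSubspace {k V : Type*} [Field k] [AddCommGroup V] [Module k V] (U : Submodule k V) :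
    Set (ℙ k V) :=
  {P | P.submodule ≤ U}

/-- The vector space spanned by `p₀, p₁, p₂` in `R_{2,1}`. -/
noncomputable def spanW {k : Type*} [Field k] (p : Fin 3 → biPiece k 2 1) : Submodule k (biPiece k 2 1) :=
  Submodule.span k (Set.range p)

/-- `W(p) = ℙ(Span(p₀, p₁, p₂)) ⊆ ℙ⁵`. -/
def planeW {k : Type*} [Field k] (p : Fin 3 → biPiece k 2 1) : Set (ℙ k (biPiece k 2 1)) :=
  projSubspace (spanW p)

/-- `S` is (the set of points of) a smooth conic in the plane `ℙ(U) ⊆ ℙ(V)`: `U` has dimension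
three, and `S` is the zero locus in `ℙ(U)` of a quadratic form `Q` on `U` whose derivative
`polar Q u` does not vanish at any zero `u ≠ 0` of `Q` (the Jacobian criterion, which is correct
in every characteristic, including two). -/
def IsSmoothConicIn {k V : Type*} [Field k] [AddCommGroup V] [Module k V] (U : Submodule k V)
    (S : Set (ℙ k V)) : Prop :=
  Module.finrank k U = 3 ∧
    ∃ Q : QuadraticForm k U,
      (∀ u : U, u ≠ 0 → Q u = 0 → ∃ v : U, QuadraticMap.polar Q u v ≠ 0) ∧
      S = {P | P ∈ projSubspace U ∧ ∀ u : U, (u : V) ∈ P.submodule → Q u = 0}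

/-!
Write `pᵢ = z aᵢ + w bᵢ` with quadratic forms `aᵢ, bᵢ` in `x, y`, and let `A, B` be the `3 × 3`
matrices whose columns are the coefficient vectors of the `aᵢ` and the `bᵢ`. A syzygy in
`Syz(p)_{2,n}` has entries in `k[z, w]`, so it is a kernel vector of the matrix `z A + w B` over
`k[z, w]` (`mem_biSyzPiece_iff`). A point `[∑ cᵢ pᵢ]` of `W(p)` lies on `Y` if and only if
`z A + w B` annihilates `c` for some `(z : w)` (`mk_linearCombination_mem_segreY`). Both sides of the
theorem are thus controlled by the kernel of the pencil `z A + w B`.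

As `p` has no common zero, the pencil is far from degenerate: `A` and `B` have no common kernel
(`PencilBasePointFree.eq_zero_of_mulVec`), `z A + w B` has rank at least two for every
`(z : w)` (`PencilBasePointFree.cross_eq_zero_of_mulVec_pencil`), and no two independent members of
the net are multiples of the same quadratic form (`PencilBasePointFree.cross_eq_zero`).

If `det (z A + w B)` is not identically zero, then there are no syzygies (`biSyzPiece_eq_bot`), and
`W(p) ∩ Y` has at most one point over each of the finitely many roots of the determinant
(`PencilBasePointFree.finite_inter`).

If the determinant vanishes identically, a column of the adjugate is a kernel vector
`z² u + zw v + w² t` of degree two, and nondegeneracy forces `u, v, t` to be a basis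
(`PencilBasePointFree.exists_isQuadraticKernel`). In this basis the kernel of the pencil at `(z : w)`
is spanned by `(z², zw, w²)`. So `W(p) ∩ Y` is the conic `Y² = XZ` (`isSmoothConicIn_spanW`), which is
infinite (`infinite_inter`), and every syzygy is a multiple of `(z², zw, w²)`
(`exists_eq_smul_veroneseSyzygy`). The two cases exclude each other, which gives the theorem.
-/

open Matrix

/-! ### Pencils of matrices without base points -/

/-- The Veronese vector `(x², xy, y²)`: pairing it with the coefficient vector of a binary quadratic
form evaluates that form at `(x, y)`. -/
def veronese {k : Type*} [Field k] (x y : k) : Fin 3 → k := ![x ^ 2, x * y, y ^ 2]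

/-- The value at `(z, w)` of the pencil of matrices spanned by `A` and `B`. -/
def pencil {k : Type*} [Field k] (A B : Matrix (Fin 3) (Fin 3) k) (z w : k) :
    Matrix (Fin 3) (Fin 3) k :=
  z • A + w • B

/-- The matrix form of `NoCommonZero`: the columns of `A` and `B` are the coefficient vectors of the
quadratic forms `aᵢ, bᵢ` with `pᵢ = z aᵢ + w bᵢ`. -/
def PencilBasePointFree {k : Type*} [Field k] (A B : Matrix (Fin 3) (Fin 3) k) : Prop :=
  ∀ x y z w : k, (x ≠ 0 ∨ y ≠ 0) → (z ≠ 0 ∨ w ≠ 0) → veronese x y ᵥ* pencil A B z w ≠ 0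

section CrossProduct

variable {k : Type*} [Field k]

theorem exists_smul_eq_of_cross_eq_zero {n c : Fin 3 → k} (hn : n ≠ 0) (h : n ⨯₃ c = 0) :
    ∃ l : k, c = l • n := by
  by_contra hc
  push Not at hc
  refine (crossProduct_ne_zero_iff_linearIndependent.2 ?_) h
  refine (LinearIndependent.pair_iff' hn).2 fun a ha => hc a ha.symm

theorem exists_smul_cross {a b c : Fin 3 → k} (hab : a ⨯₃ b ≠ 0) (ha : a ⬝ᵥ c = 0)
    (hb : b ⬝ᵥ c = 0) : ∃ l : k, c = l • (a ⨯₃ b) := by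
  refine exists_smul_eq_of_cross_eq_zero hab ?_
  simp only [dotProduct, Fin.sum_univ_three] at ha hb
  ext i
  fin_cases i <;> simp [cross_apply]
  · linear_combination b 0 * ha - a 0 * hb
  · linear_combination b 1 * ha - a 1 * hb
  · linear_combination b 2 * ha - a 2 * hb

theorem cross_eq_zero_of_dotProduct {a b c d : Fin 3 → k} (hab : a ⨯₃ b ≠ 0) (hac : a ⬝ᵥ c = 0)
    (hbc : b ⬝ᵥ c = 0) (had : a ⬝ᵥ d = 0) (hbd : b ⬝ᵥ d = 0) : c ⨯₃ d = 0 := by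
  obtain ⟨l, rfl⟩ := exists_smul_cross hab hac hbc
  obtain ⟨m, rfl⟩ := exists_smul_cross hab had hbd
  simp [cross_self]

end CrossProduct

section Pencil

variable {k : Type*} [Field k]

theorem mulVec_pencil (A B : Matrix (Fin 3) (Fin 3) k) (z w : k) (c : Fin 3 → k) :
    pencil A B z w *ᵥ c = z • (A *ᵥ c) + w • (B *ᵥ c) := by
  simp [pencil, add_mulVec, smul_mulVec]

theorem vecMul_pencil (A B : Matrix (Fin 3) (Fin 3) k) (z w : k) (c : Fin 3 → k) :
    c ᵥ* pencil A B z w = z • (c ᵥ* A) + w • (c ᵥ* B) := by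
  simp [pencil, vecMul_add, vecMul_smul]

variable [IsAlgClosed k]

theorem exists_zero_binary_quartic (c : Fin 5 → k) : ∃ x y : k, (x ≠ 0 ∨ y ≠ 0) ∧
    c 4 * x ^ 4 + c 3 * x ^ 3 * y + c 2 * x ^ 2 * y ^ 2 + c 1 * x * y ^ 3 + c 0 * y ^ 4 = 0 := by
  by_cases h : c 4 = 0
  · exact ⟨1, 0, by simp, by simp [h]⟩
  · let P : Polynomial k := .C (c 4) * .X ^ 4 + .C (c 3) * .X ^ 3 + .C (c 2) * .X ^ 2 +
      .C (c 1) * .X + .C (c 0)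
    have hd : P.degree = 4 := by
      simp only [P]
      compute_degree!
    obtain ⟨x, hx⟩ := IsAlgClosed.exists_root P (by rw [hd]; decide)
    refine ⟨x, 1, by simp, ?_⟩
    simpa [P, Polynomial.IsRoot] using hx

/-- Applied to the square of the form, the quartic case gives the quadratic one. -/
theorem exists_veronese_dotProduct_eq_zero (g : Fin 3 → k) :
    ∃ x y : k, (x ≠ 0 ∨ y ≠ 0) ∧ veronese x y ⬝ᵥ g = 0 := by
  obtain ⟨x, y, h, e⟩ := exists_zero_binary_quartic
    ![g 2 ^ 2, 2 * g 1 * g 2, g 1 ^ 2 + 2 * g 0 * g 2, 2 * g 0 * g 1, g 0 ^ 2]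
  refine ⟨x, y, h, pow_eq_zero_iff (n := 2) two_ne_zero |>.1 ?_⟩
  simp only [Fin.isValue, cons_val, cons_val_zero, cons_val_one] at e
  simp only [veronese, dotProduct, Fin.sum_univ_three, cons_val, cons_val_zero, cons_val_one]
  linear_combination e

variable {A B : Matrix (Fin 3) (Fin 3) k}

theorem PencilBasePointFree.cross_ne_zero {k : Type*} [Field k] {A B : Matrix (Fin 3) (Fin 3) k}
    (H : PencilBasePointFree A B) {x y : k} (hxy : x ≠ 0 ∨ y ≠ 0) :
    (veronese x y ᵥ* A) ⨯₃ (veronese x y ᵥ* B) ≠ 0 := by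
  rw [crossProduct_ne_zero_iff_linearIndependent, LinearIndependent.pair_iff]
  intro s t h
  by_contra hst
  refine H x y s t hxy (by tauto) ?_
  rw [vecMul_pencil, h]

/-- The three forms are linearly independent: two forms of bidegree `(2, 1)` always have a common
zero, over any root of the quartic resultant that eliminates `(z : w)`. -/
theorem PencilBasePointFree.eq_zero_of_mulVec (H : PencilBasePointFree A B) {c : Fin 3 → k}
    (hA : A *ᵥ c = 0) (hB : B *ᵥ c = 0) : c = 0 := by
  by_contra hc
  obtain ⟨i, hi⟩ := Function.ne_iff.1 hc
  have key : ∃ x y : k, (x ≠ 0 ∨ y ≠ 0) ∧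
      ((veronese x y ᵥ* A) ⨯₃ (veronese x y ᵥ* B)) i = 0 := by
    let q (j l : Fin 3) : Fin 5 → k := ![A 2 j * B 2 l - A 2 l * B 2 j,
      A 1 j * B 2 l + A 2 j * B 1 l - A 1 l * B 2 j - A 2 l * B 1 j,
      A 0 j * B 2 l + A 1 j * B 1 l + A 2 j * B 0 l
        - A 0 l * B 2 j - A 1 l * B 1 j - A 2 l * B 0 j,
      A 0 j * B 1 l + A 1 j * B 0 l - A 0 l * B 1 j - A 1 l * B 0 j,
      A 0 j * B 0 l - A 0 l * B 0 j]
    have key2 (j l : Fin 3) : ∃ x y : k, (x ≠ 0 ∨ y ≠ 0) ∧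
        (veronese x y ᵥ* A) j * (veronese x y ᵥ* B) l -
          (veronese x y ᵥ* A) l * (veronese x y ᵥ* B) j = 0 := by
      obtain ⟨x, y, h, e⟩ := exists_zero_binary_quartic (q j l)
      refine ⟨x, y, h, ?_⟩
      simp [q, veronese, vecMul, dotProduct, Fin.sum_univ_three] at e ⊢
      linear_combination e
    fin_cases i
    · simpa [cross_apply] using key2 1 2
    · simpa [cross_apply] using key2 2 0
    · simpa [cross_apply] using key2 0 1
  obtain ⟨x, y, hxy, h0⟩ := key
  have hn := H.cross_ne_zero hxy
  obtain ⟨l, hl⟩ := exists_smul_cross hn (c := c)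
    (by rw [← dotProduct_mulVec, hA, dotProduct_zero])
    (by rw [← dotProduct_mulVec, hB, dotProduct_zero])
  apply hi
  rw [hl, Pi.smul_apply, h0, smul_zero, Pi.zero_apply]

/-- At most one member of the net, up to scalars, is a multiple of a given quadratic form `g`:
otherwise a root of `g`, together with the root `(z : w)` of a third member, is a common zero. -/
theorem PencilBasePointFree.cross_eq_zero (H : PencilBasePointFree A B) {c d g : Fin 3 → k}
    (hAc : ∃ l : k, A *ᵥ c = l • g) (hBc : ∃ l : k, B *ᵥ c = l • g)
    (hAd : ∃ l : k, A *ᵥ d = l • g) (hBd : ∃ l : k, B *ᵥ d = l • g) : c ⨯₃ d = 0 := by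
  obtain ⟨x, y, hxy, hg⟩ := exists_veronese_dotProduct_eq_zero g
  have aux {M : Matrix (Fin 3) (Fin 3) k} {e : Fin 3 → k} (h : ∃ l : k, M *ᵥ e = l • g) :
      (veronese x y ᵥ* M) ⬝ᵥ e = 0 := by
    obtain ⟨l, hl⟩ := h
    rw [← dotProduct_mulVec, hl, dotProduct_smul, hg, smul_zero]
  exact cross_eq_zero_of_dotProduct (H.cross_ne_zero hxy) (aux hAc) (aux hBc) (aux hAd) (aux hBd)

/-- A matrix of the pencil never has rank one or less: otherwise its columns are multiples of one
quadratic form, whose root is a common zero. -/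
theorem PencilBasePointFree.exists_cross_ne_zero (H : PencilBasePointFree A B) {z w : k}
    (hzw : z ≠ 0 ∨ w ≠ 0) :
    ∃ i j, (pencil A B z w).col i ⨯₃ (pencil A B z w).col j ≠ 0 := by
  by_contra! h
  have key : ∃ g : Fin 3 → k, ∀ i, ∃ l : k, (pencil A B z w).col i = l • g := by
    by_cases h0 : ∀ i, (pencil A B z w).col i = 0
    · exact ⟨0, fun i => ⟨0, by simp [h0]⟩⟩
    · push Not at h0
      obtain ⟨i, hi⟩ := h0
      exact ⟨_, fun j => exists_smul_eq_of_cross_eq_zero hi (h i j)⟩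
  obtain ⟨g, hg⟩ := key
  obtain ⟨x, y, hxy, hg0⟩ := exists_veronese_dotProduct_eq_zero g
  refine H x y z w hxy hzw (funext fun i => ?_)
  obtain ⟨l, hl⟩ := hg i
  change veronese x y ⬝ᵥ (pencil A B z w).col i = 0
  rw [hl, dotProduct_smul, hg0, smul_zero]

theorem PencilBasePointFree.adjugate_ne_zero (H : PencilBasePointFree A B) {z w : k}
    (hzw : z ≠ 0 ∨ w ≠ 0) : (pencil A B z w).adjugate ≠ 0 := by
  intro h
  obtain ⟨i, j, hij⟩ := H.exists_cross_ne_zero hzw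
  apply hij
  generalize pencil A B z w = M at h
  rw [adjugate_fin_three] at h
  have e := fun a b => congrFun (congrFun h a) b
  simp [Fin.forall_fin_succ] at e
  obtain ⟨⟨h00, h01, h02⟩, ⟨h10, h11, h12⟩, h20, h21, h22⟩ := e
  ext l
  fin_cases i <;> fin_cases j <;> fin_cases l <;> simp [cross_apply] <;> grind

theorem PencilBasePointFree.cross_eq_zero_of_mulVec_pencil (H : PencilBasePointFree A B) {z w : k}
    (hzw : z ≠ 0 ∨ w ≠ 0) {c d : Fin 3 → k} (hc : pencil A B z w *ᵥ c = 0)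
    (hd : pencil A B z w *ᵥ d = 0) : c ⨯₃ d = 0 := by
  have h := H.adjugate_ne_zero hzw
  generalize pencil A B z w = M at h hc hd
  have key : ∃ i j, M.row i ⨯₃ M.row j ≠ 0 := by
    by_contra! h'
    apply h
    have e := fun i j l => congrFun (h' i j) l
    have e1 := e 0 1
    have e2 := e 0 2
    have e3 := e 1 2
    simp [Fin.forall_fin_succ, cross_apply] at e1 e2 e3
    rw [adjugate_fin_three]
    ext i j
    fin_cases i <;> fin_cases j <;> simp <;> grind
  obtain ⟨i, j, hij⟩ := key
  exact cross_eq_zero_of_dotProduct hij (congrFun hc i) (congrFun hc j) (congrFun hd i)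
    (congrFun hd j)

/-- The Kronecker chain condition: `z² u + z w v + w² t` is annihilated by `z A + w B`, identically
in `z` and `w`. -/
structure IsQuadraticKernel {k : Type*} [Field k] (A B : Matrix (Fin 3) (Fin 3) k)
    (u v t : Fin 3 → k) : Prop where
  left : A *ᵥ u = 0
  midLeft : A *ᵥ v + B *ᵥ u = 0
  midRight : A *ᵥ t + B *ᵥ v = 0
  right : B *ᵥ t = 0

theorem IsQuadraticKernel.mulVec_pencil_eq_zero {k : Type*} [Field k]
    {A B : Matrix (Fin 3) (Fin 3) k} {u v t : Fin 3 → k} (h : IsQuadraticKernel A B u v t)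
    (z w : k) : pencil A B z w *ᵥ (z ^ 2 • u + (z * w) • v + w ^ 2 • t) = 0 := by
  have e1 : A *ᵥ v = -(B *ᵥ u) := eq_neg_of_add_eq_zero_left h.midLeft
  have e2 : A *ᵥ t = -(B *ᵥ v) := eq_neg_of_add_eq_zero_left h.midRight
  simp only [mulVec_pencil, mulVec_add, mulVec_smul, h.left, h.right, e1, e2]
  module

theorem PencilBasePointFree.linearIndependent (H : PencilBasePointFree A B) {u v t : Fin 3 → k}
    (h : IsQuadraticKernel A B u v t) (hu : u ≠ 0) : LinearIndependent k ![u, v, t] := by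
  have e1 : B *ᵥ u = (-1 : k) • (A *ᵥ v) := by
    rw [neg_one_smul]; exact eq_neg_of_add_eq_zero_right h.midLeft
  have e2 : B *ᵥ v = (-1 : k) • (A *ᵥ t) := by
    rw [neg_one_smul]; exact eq_neg_of_add_eq_zero_right h.midRight
  by_contra hdep
  -- A linear relation makes `A v` and `A t` proportional to some `g`, and with them the images
  -- of `u`, `v`, `t` under both `A` and `B`.
  have key : ∃ g : Fin 3 → k, (∃ l : k, A *ᵥ v = l • g) ∧ ∃ l : k, A *ᵥ t = l • g := by
    by_cases hv : A *ᵥ v = 0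
    · exact ⟨A *ᵥ t, ⟨0, by simp [hv]⟩, 1, by simp⟩
    · refine ⟨A *ᵥ v, ⟨1, by simp⟩, ?_⟩
      by_contra hno
      push Not at hno
      have hli := (LinearIndependent.pair_iff' hv).2 fun a ha => hno a ha.symm
      rw [LinearIndependent.pair_iff] at hli
      apply hdep
      rw [Fintype.linearIndependent_iff]
      intro c hc
      simp only [Fin.sum_univ_three, cons_val_zero, cons_val_one, cons_val] at hc
      have hA := congrArg (A *ᵥ ·) hc
      have hB := congrArg (B *ᵥ ·) hc
      simp only [mulVec_add, mulVec_smul, mulVec_zero, h.left, h.right, e1, e2] at hA hB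
      obtain ⟨h1, h2⟩ := hli (c 1) (c 2) (by simpa using hA)
      obtain ⟨h0, -⟩ := hli (-c 0) (-c 1) (by simpa using hB)
      simp [Fin.forall_fin_succ, h1, h2, neg_eq_zero.1 h0]
  obtain ⟨g, ⟨l, hl⟩, m, hm⟩ := key
  have hAu : ∃ l : k, A *ᵥ u = l • g := ⟨0, by simp [h.left]⟩
  have hBu : ∃ l : k, B *ᵥ u = l • g := ⟨-1 * l, by rw [e1, hl, smul_smul]⟩
  have hBv : ∃ l : k, B *ᵥ v = l • g := ⟨-1 * m, by rw [e2, hm, smul_smul]⟩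
  obtain ⟨b, rfl⟩ := exists_smul_eq_of_cross_eq_zero hu (H.cross_eq_zero hAu hBu ⟨l, hl⟩ hBv)
  apply hu
  refine H.eq_zero_of_mulVec h.left ?_
  rw [e1, mulVec_smul, h.left, smul_zero, smul_zero]

/-- A column of `adj (z A + w B)` is a kernel vector of degree two; its coefficient of `z²` is a
column of `adj A`. -/
theorem PencilBasePointFree.exists_isQuadraticKernel (H : PencilBasePointFree A B)
    (hdet : ∀ z w : k, (pencil A B z w).det = 0) :
    ∃ u v t, IsQuadraticKernel A B u v t ∧ LinearIndependent k ![u, v, t] := by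
  obtain ⟨N, hN⟩ : ∃ N, ∀ z w : k, (pencil A B z w).adjugate =
      z ^ 2 • A.adjugate + (z * w) • N + w ^ 2 • B.adjugate := by
    refine ⟨(A + B).adjugate - A.adjugate - B.adjugate, fun z w => ?_⟩
    simp only [pencil, adjugate_fin_three]
    ext i j
    fin_cases i <;> fin_cases j <;> simp <;> ring
  have hA : A * A.adjugate = 0 := by
    have := hdet 1 0
    rw [mul_adjugate, ← show pencil A B 1 0 = A by simp [pencil], this, zero_smul]
  have hB : B * B.adjugate = 0 := by
    have := hdet 0 1
    rw [mul_adjugate, ← show pencil A B 0 1 = B by simp [pencil], this, zero_smul]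
  have hmul (z w : k) : (z ^ 2 * w) • (A * N + B * A.adjugate) +
      (z * w ^ 2) • (A * B.adjugate + B * N) = 0 := by
    have h0 := mul_adjugate (pencil A B z w)
    rw [hdet, zero_smul, hN, pencil] at h0
    simp only [add_mul, mul_add, smul_mul_assoc, mul_smul_comm, hA, hB] at h0
    rw [← h0]
    module
  -- Two values `1` and `a ≠ 0, 1` of `z` separate the two mixed coefficients.
  classical
  obtain ⟨a, ha⟩ := Infinite.exists_notMem_finset ({0, 1} : Finset k)
  simp only [Finset.mem_insert, Finset.mem_singleton, not_or] at ha
  have h1 := hmul 1 1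
  have h2 := hmul a 1
  have hP : A * N + B * A.adjugate = 0 := by
    have h3 : (a * (a - 1)) • (A * N + B * A.adjugate) = 0 := by
      have : (a * (a - 1)) • (A * N + B * A.adjugate) =
        ((a ^ 2 * 1) • (A * N + B * A.adjugate) + (a * 1 ^ 2) • (A * B.adjugate + B * N)) -
        a • ((1 ^ 2 * 1 : k) • (A * N + B * A.adjugate) +
          (1 * 1 ^ 2 : k) • (A * B.adjugate + B * N)) := by module
      rw [this, h1, h2]; simp
    exact (smul_eq_zero.1 h3).resolve_left (mul_ne_zero ha.1 (sub_ne_zero.2 ha.2))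
  have hQ : A * B.adjugate + B * N = 0 := by simpa [hP] using h1
  have hne : A.adjugate ≠ 0 := by
    simpa [pencil] using H.adjugate_ne_zero (z := 1) (w := 0) (by simp)
  obtain ⟨j, hj⟩ : ∃ j, A.adjugate.col j ≠ 0 := by
    by_contra! h
    exact hne (Matrix.ext fun i j => congrFun (h j) i)
  have col (j : Fin 3) (M N : Matrix (Fin 3) (Fin 3) k) : M *ᵥ N.col j = (M * N).col j := rfl
  have hker : IsQuadraticKernel A B (A.adjugate.col j) (N.col j) (B.adjugate.col j) := by
    refine ⟨?_, ?_, ?_, ?_⟩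
    · rw [col, hA]; rfl
    · rw [col, col]; exact funext fun i => congrFun (congrFun hP i) j
    · rw [col, col]; exact funext fun i => congrFun (congrFun hQ i) j
    · rw [col, hB]; rfl
  exact ⟨_, _, _, hker, H.linearIndependent hker hj⟩

end Pencil

/-! ### Bihomogeneous forms and the Segre variety -/

section BiPiece

variable {k : Type*} [Field k]

/-- The exponent vector of `x ^ (m - i) y ^ i z ^ (n - j) w ^ j`. -/
noncomputable def biExp (m n : ℕ) (q : Fin (m + 1) × Fin (n + 1)) : Fin 4 →₀ ℕ :=
  Finsupp.equivFunOnFinite.symm ![m - q.1, q.1, n - q.2, q.2]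

theorem biExp_injective (m n : ℕ) : Function.Injective (biExp m n) := by
  intro q r h
  have h1 := DFunLike.congr_fun h 1
  have h3 := DFunLike.congr_fun h 3
  simp [biExp] at h1 h3
  exact Prod.ext (Fin.ext h1) (Fin.ext h3)

theorem weight_biWeight (d : Fin 4 →₀ ℕ) :
    Finsupp.weight biWeight d = ((d 0 + d 1 : ℤ), (d 2 + d 3 : ℤ)) := by
  rw [Finsupp.weight_apply, Finsupp.sum_fintype _ _ (by simp), Fin.sum_univ_four]
  simp [biWeight]

theorem range_biExp (m n : ℕ) :
    Set.range (biExp m n) = {d | Finsupp.weight biWeight d = ((m : ℤ), (n : ℤ))} := by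
  ext d
  simp only [Set.mem_range, Set.mem_ofPred_eq, weight_biWeight, Prod.mk.injEq]
  constructor
  · rintro ⟨⟨i, j⟩, rfl⟩
    simp [biExp]
    omega
  · rintro ⟨h1, h2⟩
    refine ⟨(⟨d 1, by omega⟩, ⟨d 3, by omega⟩), ?_⟩
    ext i
    fin_cases i <;> simp [biExp] <;> omega

theorem biPiece_eq_restrictSupport (m n : ℕ) :
    biPiece k m n = MvPolynomial.restrictSupport k (Set.range (biExp m n)) := by
  rw [range_biExp]
  exact MvPolynomial.weightedHomogeneousSubmodule_eq_finsupp_supported k _ _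

theorem finrank_biPiece (m n : ℕ) : Module.finrank k (biPiece k m n) = (m + 1) * (n + 1) := by
  rw [biPiece_eq_restrictSupport, Module.finrank_eq_nat_card_basis
    (MvPolynomial.basisRestrictSupport k (Set.range (biExp m n))),
    Nat.card_range_of_injective (biExp_injective m n)]
  simp

theorem exists_eval_eq_sum {m n : ℕ} {f : BiRing k} (hf : f ∈ biPiece k m n) :
    ∃ c : Fin (m + 1) × Fin (n + 1) → k, ∀ s : Fin 4 → k, MvPolynomial.eval s f =
      ∑ q, c q * (s 0 ^ (m - q.1 : ℕ) * s 1 ^ (q.1 : ℕ) * s 2 ^ (n - q.2 : ℕ) *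
        s 3 ^ (q.2 : ℕ)) := by
  rw [biPiece_eq_restrictSupport, MvPolynomial.restrictSupport_eq_span, ← Set.range_comp,
    Submodule.mem_span_range_iff_exists_fun] at hf
  obtain ⟨c, rfl⟩ := hf
  refine ⟨c, fun s => ?_⟩
  rw [map_sum]
  refine Finset.sum_congr rfl fun q _ => ?_
  rw [MvPolynomial.smul_eval, Function.comp_apply, MvPolynomial.eval_monomial,
    Finsupp.prod_fintype _ _ (by simp), Fin.prod_univ_four, one_mul]
  simp [biExp]

theorem eval_eq_of_mem_biPiece_zero {m : ℤ} (hm : 0 ≤ m) {f : BiRing k} (hf : f ∈ biPiece k 0 m)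
    (s : Fin 4 → k) :
    MvPolynomial.eval s f = MvPolynomial.eval ![0, 0, s 2, s 3] f := by
  lift m to ℕ using hm
  obtain ⟨c, hc⟩ := exists_eval_eq_sum (m := 0) hf
  rw [hc, hc]
  simp

/-- A polynomial is bihomogeneous if its product with `z` is. -/
theorem mem_biPiece_of_X_mul {m n : ℤ} {f : BiRing k}
    (hf : MvPolynomial.X 2 * f ∈ biPiece k m (n + 1)) : f ∈ biPiece k m n := by
  intro d hd
  have h := @hf (Finsupp.single 2 1 + d) (by rwa [MvPolynomial.coeff_X_mul])
  rw [map_add, Finsupp.weight_single] at h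
  simp [biWeight, Prod.ext_iff] at h
  ext
  · exact h.1
  · have := h.2
    rw [add_comm] at this
    exact add_right_cancel this

theorem X_mul_X_mem_biPiece {i j : Fin 4} (hi : 2 ≤ i) (hj : 2 ≤ j) :
    (MvPolynomial.X i * MvPolynomial.X j : BiRing k) ∈ biPiece k 0 2 := by
  have h : ∀ i : Fin 4, 2 ≤ i → biWeight i = (0, 1) := by decide
  have := (MvPolynomial.isWeightedHomogeneous_X k biWeight i).mul
    (MvPolynomial.isWeightedHomogeneous_X k biWeight j)
  rwa [h i hi, h j hj] at this

/-- The form `g₀ x² + g₁ xy + g₂ y²`. -/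
noncomputable def quadForm (g : Fin 3 → k) : biPiece k 2 0 :=
  ⟨MvPolynomial.C (g 0) * MvPolynomial.X 0 ^ 2 +
    MvPolynomial.C (g 1) * (MvPolynomial.X 0 * MvPolynomial.X 1) +
    MvPolynomial.C (g 2) * MvPolynomial.X 1 ^ 2, by
    have h := MvPolynomial.isWeightedHomogeneous_X k biWeight
    have h0 := ((h 0).pow 2).C_mul (g 0)
    have h1 := ((h 0).mul (h 1)).C_mul (g 1)
    have h2 := ((h 1).pow 2).C_mul (g 2)
    exact (h0.add h1).add h2⟩

/-- The form `h₀ z + h₁ w`. -/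
noncomputable def linForm (h : Fin 2 → k) : biPiece k 0 1 :=
  ⟨MvPolynomial.C (h 0) * MvPolynomial.X 2 + MvPolynomial.C (h 1) * MvPolynomial.X 3, by
    have e := MvPolynomial.isWeightedHomogeneous_X k biWeight
    exact ((e 2).C_mul (h 0)).add ((e 3).C_mul (h 1))⟩

/-- The form `z a + w b`, where `a` and `b` are the coefficient vectors of quadratic forms in
`x` and `y`. -/
noncomputable def biForm (a b : Fin 3 → k) : biPiece k 2 1 :=
  segreMul (quadForm a) (linForm ![1, 0]) + segreMul (quadForm b) (linForm ![0, 1])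

theorem eval_quadForm (g : Fin 3 → k) (s : Fin 4 → k) :
    MvPolynomial.eval s (quadForm g : BiRing k) = veronese (s 0) (s 1) ⬝ᵥ g := by
  simp [quadForm, veronese, dotProduct, Fin.sum_univ_three]
  ring

theorem eval_linForm (h : Fin 2 → k) (s : Fin 4 → k) :
    MvPolynomial.eval s (linForm h : BiRing k) = h 0 * s 2 + h 1 * s 3 := by
  simp [linForm]

theorem eval_segreMul (g : biPiece k 2 0) (h : biPiece k 0 1) (s : Fin 4 → k) :
    MvPolynomial.eval s (segreMul g h : BiRing k) =
      MvPolynomial.eval s (g : BiRing k) * MvPolynomial.eval s (h : BiRing k) := by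
  simp [segreMul]

theorem eval_biForm (a b : Fin 3 → k) (s : Fin 4 → k) :
    MvPolynomial.eval s (biForm a b : BiRing k) =
      veronese (s 0) (s 1) ⬝ᵥ (s 2 • a + s 3 • b) := by
  rw [biForm, Submodule.coe_add, map_add, eval_segreMul, eval_segreMul, eval_quadForm,
    eval_quadForm, eval_linForm, eval_linForm]
  simp [dotProduct_add]
  ring

theorem eq_zero_of_veronese_dotProduct {g : Fin 3 → k} (h : ∀ x y, veronese x y ⬝ᵥ g = 0) :
    g = 0 := by
  have h0 := h 1 0
  have h2 := h 0 1
  have h1 := h 1 1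
  simp [veronese, dotProduct, Fin.sum_univ_three] at h0 h1 h2
  ext i
  fin_cases i
  · exact h0
  · simpa [h0, h2] using h1
  · exact h2

theorem biForm_eq_zero {a b : Fin 3 → k} : biForm a b = 0 ↔ a = 0 ∧ b = 0 := by
  constructor
  · intro h
    have e (z w : k) : z • a + w • b = 0 := eq_zero_of_veronese_dotProduct fun x y => by
      have := eval_biForm a b ![x, y, z, w]
      rw [h] at this
      simpa using this.symm
    exact ⟨by simpa using e 1 0, by simpa using e 0 1⟩
  · rintro ⟨rfl, rfl⟩
    simp [biForm, segreMul, quadForm]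

variable [Infinite k]

theorem biPiece_ext {m n : ℤ} {f g : biPiece k m n} (h : ∀ s, MvPolynomial.eval s (f : BiRing k) =
    MvPolynomial.eval s (g : BiRing k)) : f = g :=
  Subtype.ext (MvPolynomial.funext h)

theorem exists_eq_quadForm (f : biPiece k 2 0) : ∃ g, f = quadForm g := by
  obtain ⟨c, hc⟩ := exists_eval_eq_sum (m := 2) (n := 0) f.2
  refine ⟨fun i => c (i, 0), biPiece_ext fun s => ?_⟩
  rw [hc, eval_quadForm, Fintype.sum_prod_type]
  simp [veronese, dotProduct, Fin.sum_univ_three]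
  ring

theorem exists_eq_linForm (f : biPiece k 0 1) : ∃ h, f = linForm h := by
  obtain ⟨c, hc⟩ := exists_eval_eq_sum (m := 0) (n := 1) f.2
  refine ⟨fun i => c (0, i), biPiece_ext fun s => ?_⟩
  rw [hc, eval_linForm, Fintype.sum_prod_type]
  simp

theorem exists_eq_biForm (f : biPiece k 2 1) : ∃ a b, f = biForm a b := by
  obtain ⟨c, hc⟩ := exists_eval_eq_sum (m := 2) (n := 1) f.2
  refine ⟨fun i => c (i, 0), fun i => c (i, 1), biPiece_ext fun s => ?_⟩
  rw [hc, eval_biForm, Fintype.sum_prod_type]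
  simp [veronese, dotProduct, Fin.sum_univ_three]
  ring

theorem smul_biForm (l : k) (a b : Fin 3 → k) : l • biForm a b = biForm (l • a) (l • b) := by
  refine biPiece_ext fun s => ?_
  rw [Submodule.coe_smul, MvPolynomial.smul_eval, eval_biForm, eval_biForm, smul_comm _ l,
    smul_comm _ l, ← smul_add, dotProduct_smul, smul_eq_mul]

theorem segreMul_quadForm_linForm (g : Fin 3 → k) (h : Fin 2 → k) :
    segreMul (quadForm g) (linForm h) = biForm (h 0 • g) (h 1 • g) := by
  refine biPiece_ext fun s => ?_
  rw [eval_segreMul, eval_quadForm, eval_linForm, eval_biForm, smul_smul, smul_smul, ← add_smul,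
    dotProduct_smul, smul_eq_mul]
  ring

theorem biForm_injective {a b a' b' : Fin 3 → k} (h : biForm a b = biForm a' b') :
    a = a' ∧ b = b' := by
  have : biForm (a - a') (b - b') = 0 := by
    refine biPiece_ext fun s => ?_
    have e := congrArg (fun f : biPiece k 2 1 => MvPolynomial.eval s (f : BiRing k)) h
    simp only [eval_biForm] at e
    rw [eval_biForm, smul_sub, smul_sub, sub_add_sub_comm, dotProduct_sub, e]
    simp
  rw [biForm_eq_zero] at this
  exact ⟨sub_eq_zero.1 this.1, sub_eq_zero.1 this.2⟩

/-- The Segre variety consists of the forms `z a + w b` that vanish identically over some point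
`(z : w)` of the second factor. -/
theorem mk_biForm_mem_segreY {a b : Fin 3 → k} (hab : biForm a b ≠ 0) :
    Projectivization.mk k (biForm a b) hab ∈ segreY k ↔
      ∃ z w : k, (z ≠ 0 ∨ w ≠ 0) ∧ z • a + w • b = 0 := by
  constructor
  · rintro ⟨⟨P₁, P₂⟩, hP⟩
    obtain ⟨g, hg⟩ := exists_eq_quadForm P₁.rep
    obtain ⟨h, hh⟩ := exists_eq_linForm P₂.rep
    have hh0 := P₂.rep_nonzero
    rw [segreMap, Projectivization.mk_eq_mk_iff] at hP
    obtain ⟨l, hl⟩ := hP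
    rw [Units.smul_def] at hl
    simp only [hg, hh, segreMul_quadForm_linForm, smul_biForm] at hl
    obtain ⟨e1, e2⟩ := biForm_injective hl
    refine ⟨h 1 * l, -(h 0 * l), ?_, ?_⟩
    · by_contra hc
      push Not at hc
      apply hh0
      rw [hh]
      refine biPiece_ext fun s => ?_
      rw [eval_linForm, (mul_eq_zero.1 hc.1).resolve_right l.ne_zero,
        (mul_eq_zero.1 (neg_eq_zero.1 hc.2)).resolve_right l.ne_zero]
      simp
    · rw [neg_smul, mul_smul, mul_smul, e1, e2]
      module
  · rintro ⟨z, w, hzw, h⟩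
    have key : ∃ g : Fin 3 → k, a = (-w) • g ∧ b = z • g := by
      by_cases hz : z = 0
      · have hw : w ≠ 0 := by tauto
        subst hz
        refine ⟨(-w)⁻¹ • a, (smul_inv_smul₀ (neg_ne_zero.2 hw) a).symm, ?_⟩
        rw [zero_smul, zero_add] at h
        rw [zero_smul]
        exact (smul_eq_zero.1 h).resolve_left hw
      · refine ⟨z⁻¹ • b, ?_, (smul_inv_smul₀ hz b).symm⟩
        rw [smul_comm, eq_inv_smul_iff₀ hz, neg_smul]
        exact eq_neg_of_add_eq_zero_left h
    obtain ⟨g, rfl, rfl⟩ := key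
    have e : biForm ((-w) • g) (z • g) = segreMul (quadForm g) (linForm ![-w, z]) := by
      rw [segreMul_quadForm_linForm]; rfl
    have hg : quadForm g ≠ 0 := fun h0 => hab (by
      rw [e]; apply Subtype.ext; simp [segreMul, h0])
    have hl : linForm ![-w, z] ≠ 0 := fun h0 => hab (by
      rw [e]; apply Subtype.ext; simp [segreMul, h0])
    refine ⟨(Projectivization.mk k _ hg, Projectivization.mk k _ hl), ?_⟩
    rw [segreMap_mk]
    congr 1
    exact e.symm

end BiPiece

/-! ### Nets of forms and the kernel of the pencil -/

section Net

variable {k : Type*} [Field k] [Infinite k]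

theorem exists_matrix_eq_biForm (p : Fin 3 → biPiece k 2 1) :
    ∃ A B : Matrix (Fin 3) (Fin 3) k, ∀ i, p i = biForm (A.col i) (B.col i) := by
  choose a b h using fun i => exists_eq_biForm (p i)
  exact ⟨fun i j => a j i, fun i j => b j i, h⟩

variable {p : Fin 3 → biPiece k 2 1} {A B : Matrix (Fin 3) (Fin 3) k}

theorem eval_eq_vecMul_pencil {k : Type*} [Field k] {p : Fin 3 → biPiece k 2 1}
    {A B : Matrix (Fin 3) (Fin 3) k} (hp : ∀ i, p i = biForm (A.col i) (B.col i)) (s : Fin 4 → k)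
    (i : Fin 3) : MvPolynomial.eval s (p i : BiRing k) =
      (veronese (s 0) (s 1) ᵥ* pencil A B (s 2) (s 3)) i := by
  rw [hp, eval_biForm]
  rfl

theorem linearCombination_eq_biForm (hp : ∀ i, p i = biForm (A.col i) (B.col i)) (c : Fin 3 → k) :
    Fintype.linearCombination k p c = biForm (A *ᵥ c) (B *ᵥ c) := by
  refine biPiece_ext fun s => ?_
  rw [eval_biForm, ← mulVec_pencil, dotProduct_mulVec, Fintype.linearCombination_apply,
    Submodule.coe_sum, map_sum]
  refine Finset.sum_congr rfl fun i _ => ?_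
  rw [Submodule.coe_smul, MvPolynomial.smul_eval, eval_eq_vecMul_pencil hp, mul_comm]

theorem pencilBasePointFree {k : Type*} [Field k] {p : Fin 3 → biPiece k 2 1}
    {A B : Matrix (Fin 3) (Fin 3) k} (hp : ∀ i, p i = biForm (A.col i) (B.col i))
    (h : NoCommonZero p) :
    PencilBasePointFree A B := by
  intro x y z w hxy hzw h0
  obtain ⟨i, hi⟩ := h x y z w hxy hzw
  apply hi
  rw [eval_eq_vecMul_pencil hp]
  exact congrFun h0 i

/-- A triple of forms in `z` and `w` is a syzygy if and only if all its values are in the kernel of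
the pencil. -/
theorem mem_biSyzPiece_iff (hp : ∀ i, p i = biForm (A.col i) (B.col i)) {n : ℤ} (hn : 1 ≤ n)
    {τ : Fin 3 → BiRing k} : τ ∈ biSyzPiece p 2 n ↔ (∀ i, τ i ∈ biPiece k 0 (n - 1)) ∧
      ∀ s : Fin 4 → k, pencil A B (s 2) (s 3) *ᵥ (fun i => MvPolynomial.eval s (τ i)) = 0 := by
  have hsyz : τ ∈ biSyz p ↔ ∀ s : Fin 4 → k, veronese (s 0) (s 1) ⬝ᵥ
      pencil A B (s 2) (s 3) *ᵥ (fun i => MvPolynomial.eval s (τ i)) = 0 := by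
    have e (s : Fin 4 → k) : veronese (s 0) (s 1) ⬝ᵥ
        pencil A B (s 2) (s 3) *ᵥ (fun i => MvPolynomial.eval s (τ i)) =
        MvPolynomial.eval s (Fintype.linearCombination (BiRing k)
          (fun i => (p i : BiRing k)) τ) := by
      rw [dotProduct_mulVec, Fintype.linearCombination_apply, map_sum]
      refine Finset.sum_congr rfl fun i _ => ?_
      rw [smul_eq_mul, map_mul, eval_eq_vecMul_pencil hp, mul_comm]
    simp only [e]
    rw [biSyz, LinearMap.mem_ker]
    constructor
    · intro h s
      rw [h, map_zero]
    · intro h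
      exact MvPolynomial.funext fun s => by rw [h, map_zero]
  have hpi : τ ∈ Submodule.pi Set.univ (fun _ : Fin 3 => biPiece k (2 - 2) (n - 1)) ↔
      ∀ i, τ i ∈ biPiece k 0 (n - 1) := by simp [Submodule.mem_pi]
  rw [biSyzPiece, Submodule.mem_inf, Submodule.restrictScalars_mem, hpi, hsyz, and_comm]
  refine and_congr_right fun hτ => ⟨fun h s => ?_, fun h s => by rw [h, dotProduct_zero]⟩
  refine eq_zero_of_veronese_dotProduct fun x y => ?_
  have e : (fun i => MvPolynomial.eval s (τ i)) =
      fun i => MvPolynomial.eval ![x, y, s 2, s 3] (τ i) := by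
    funext i
    rw [eval_eq_of_mem_biPiece_zero (by omega) (hτ i),
      eval_eq_of_mem_biPiece_zero (by omega) (hτ i) ![x, y, s 2, s 3]]
    rfl
  rw [e]
  exact h ![x, y, s 2, s 3]

theorem biSyzPiece_eq_bot (hp : ∀ i, p i = biForm (A.col i) (B.col i)) {z w : k}
    (hdet : (pencil A B z w).det ≠ 0) {n : ℤ} (hn : 1 ≤ n) : biSyzPiece p 2 n = ⊥ := by
  rw [eq_bot_iff]
  intro τ hτ
  rw [mem_biSyzPiece_iff hp hn] at hτ
  let D : BiRing k := det ((MvPolynomial.X 2 : BiRing k) • A.map MvPolynomial.C +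
    (MvPolynomial.X 3 : BiRing k) • B.map MvPolynomial.C)
  have hD (s : Fin 4 → k) : MvPolynomial.eval s D = (pencil A B (s 2) (s 3)).det := by
    rw [RingHom.map_det]
    congr 1
    ext i j
    simp [pencil]
  have hD0 : D ≠ 0 := by
    intro h
    have := hD ![0, 0, z, w]
    rw [h, map_zero] at this
    exact hdet this.symm
  refine funext fun i => (mul_eq_zero.1 (?_ : D * τ i = 0)).resolve_left hD0
  refine MvPolynomial.funext fun s => ?_
  rw [map_mul, map_zero, hD, mul_eq_zero, or_iff_not_imp_left]
  intro h
  exact congrFun (eq_zero_of_mulVec_eq_zero h (hτ.2 s)) i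

/-- The points of `W(p)` are those of the form `[∑ cᵢ pᵢ]`. -/
theorem mem_planeW_iff {k : Type*} [Field k] {p : Fin 3 → biPiece k 2 1} {P : ℙ k (biPiece k 2 1)} :
    P ∈ planeW p ↔ ∃ c, ∃ h : Fintype.linearCombination k p c ≠ 0, P = .mk k _ h := by
  constructor
  · intro h
    have h1 : P.rep ∈ spanW p := by
      have h2 : P.submodule ≤ spanW p := h
      rw [Projectivization.submodule_eq] at h2
      exact h2 (Submodule.mem_span_singleton_self _)
    rw [spanW, ← Fintype.range_linearCombination] at h1
    obtain ⟨c, hc⟩ := h1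
    exact ⟨c, hc ▸ P.rep_nonzero, by simp only [hc, Projectivization.mk_rep]⟩
  · rintro ⟨c, h, rfl⟩
    change Projectivization.submodule _ ≤ spanW p
    rw [Projectivization.submodule_mk, Submodule.span_singleton_le_iff_mem, spanW,
      ← Fintype.range_linearCombination]
    exact ⟨c, rfl⟩

theorem mk_linearCombination_mem_segreY (hp : ∀ i, p i = biForm (A.col i) (B.col i))
    {c : Fin 3 → k} (h : Fintype.linearCombination k p c ≠ 0) :
    Projectivization.mk k _ h ∈ segreY k ↔
      ∃ z w : k, (z ≠ 0 ∨ w ≠ 0) ∧ pencil A B z w *ᵥ c = 0 := by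
  simp only [linearCombination_eq_biForm hp, mulVec_pencil]
  exact mk_biForm_mem_segreY _

theorem det_pencil_eq_zero {k : Type*} [Field k] {A B : Matrix (Fin 3) (Fin 3) k}
    (hA : A.det = 0) (h : ∀ z, (pencil A B z 1).det = 0) (z w : k) : (pencil A B z w).det = 0 := by
  by_cases hw : w = 0
  · simp [hw, pencil, hA]
  · have : pencil A B z w = w • pencil A B (z / w) 1 := by
      rw [pencil, pencil, smul_add, smul_smul, smul_smul, mul_div_cancel₀ _ hw, mul_one]
    rw [this, det_smul, h, mul_zero]

theorem LinearIndependent.matrix_injective {k : Type*} [Field k] {u v t : Fin 3 → k}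
    (h : LinearIndependent k ![u, v, t]) : Function.Injective (of ![u, v, t])ᵀ.mulVec := by
  rw [mulVec_injective_iff]
  exact h

end Net

/-! ### The conic and the quadratic syzygy -/

section Closed

variable {k : Type*} [Field k] [IsAlgClosed k] {p : Fin 3 → biPiece k 2 1}
  {A B : Matrix (Fin 3) (Fin 3) k}

theorem PencilBasePointFree.linearCombination_injective (H : PencilBasePointFree A B)
    (hp : ∀ i, p i = biForm (A.col i) (B.col i)) :
    Function.Injective (Fintype.linearCombination k p) := by
  rw [← LinearMap.ker_eq_bot, LinearMap.ker_eq_bot']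
  intro c hc
  rw [linearCombination_eq_biForm hp, biForm_eq_zero] at hc
  exact H.eq_zero_of_mulVec hc.1 hc.2

/-- The determinant of the pencil has finitely many roots `(z : w)`, and over each of them there is
at most one point of `W(p) ∩ Y`. -/
theorem PencilBasePointFree.finite_inter (H : PencilBasePointFree A B)
    (hp : ∀ i, p i = biForm (A.col i) (B.col i)) {z w : k} (hdet : (pencil A B z w).det ≠ 0) :
    (planeW p ∩ segreY k).Finite := by
  let D : Polynomial k := ((Polynomial.X : Polynomial k) • A.map Polynomial.C +
    B.map Polynomial.C).det
  have hD (z : k) : D.eval z = (pencil A B z 1).det := by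
    rw [← Polynomial.coe_evalRingHom, RingHom.map_det]
    congr 1
    ext i j
    simp [pencil, mul_comm z]
  have hD0 : D ≠ 0 := by
    intro h
    -- The coefficient of degree three accounts for the point `(1 : 0)` at infinity.
    refine hdet (det_pencil_eq_zero ?_ (fun z => by rw [← hD, h, Polynomial.eval_zero]) z w)
    rw [← Polynomial.coeff_det_X_add_C_card A B]
    exact (congrArg (fun q => Polynomial.coeff q _) h).trans (Polynomial.coeff_zero _)
  classical
  let T (z w : k) : Set (ℙ k (biPiece k 2 1)) := {P | ∃ c,
    ∃ h : Fintype.linearCombination k p c ≠ 0, P = .mk k _ h ∧ pencil A B z w *ᵥ c = 0}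
  have hT {z w : k} (hzw : z ≠ 0 ∨ w ≠ 0) : (T z w).Finite := by
    refine Set.Subsingleton.finite ?_
    rintro _ ⟨c, hc, rfl, hc0⟩ _ ⟨d, hd, rfl, hd0⟩
    have hd1 : d ≠ 0 := fun h => hd (by rw [h, map_zero])
    obtain ⟨l, rfl⟩ := exists_smul_eq_of_cross_eq_zero hd1
      (H.cross_eq_zero_of_mulVec_pencil hzw hd0 hc0)
    rw [Projectivization.mk_eq_mk_iff']
    exact ⟨l, (map_smul _ _ _).symm⟩
  refine ((hT (z := 1) (w := 0) (by simp)).union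
    (D.roots.toFinset.finite_toSet.biUnion fun z _ => hT (z := z) (w := 1) (by simp))).subset ?_
  rintro P ⟨hP, hY⟩
  obtain ⟨c, hc, rfl⟩ := mem_planeW_iff.1 hP
  obtain ⟨z, w, hzw, h0⟩ := (mk_linearCombination_mem_segreY hp hc).1 hY
  rw [mulVec_pencil] at h0
  by_cases hw : w = 0
  · subst hw
    refine Or.inl ⟨c, hc, rfl, ?_⟩
    have hz : z ≠ 0 := by tauto
    simpa [mulVec_pencil, hz] using h0
  · refine Or.inr ?_
    have h1 : pencil A B (z / w) 1 *ᵥ c = 0 := by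
      rw [mulVec_pencil, div_eq_inv_mul, mul_smul, one_smul, ← inv_smul_smul₀ hw (B *ᵥ c),
        ← smul_add, h0, smul_zero]
    simp only [Set.mem_iUnion]
    refine ⟨z / w, ?_, c, hc, rfl, h1⟩
    rw [Finset.mem_coe, Multiset.mem_toFinset, Polynomial.mem_roots hD0, Polynomial.IsRoot, hD]
    by_contra h2
    refine hc ?_
    rw [eq_zero_of_mulVec_eq_zero h2 h1, map_zero]

/-- The points of the Veronese conic are the zeros of `Y² - XZ`. -/
theorem exists_smul_veronese_iff {k : Type*} [Field k] {d : Fin 3 → k} (hd : d ≠ 0) :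
    (∃ z w : k, (z ≠ 0 ∨ w ≠ 0) ∧ ∃ l : k, d = l • veronese z w) ↔ d 1 * d 1 - d 0 * d 2 = 0 := by
  constructor
  · rintro ⟨z, w, -, l, rfl⟩
    simp [veronese]
    ring
  · intro h
    by_cases h0 : d 0 = 0
    · have h1 : d 1 = 0 := by simpa [h0] using h
      refine ⟨0, 1, by simp, d 2, ?_⟩
      ext i
      fin_cases i <;> simp [veronese, h0, h1]
    · refine ⟨d 0, d 1, Or.inl h0, (d 0)⁻¹, ?_⟩
      ext i
      fin_cases i <;> simp [veronese] <;> field_simp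
      linear_combination -h

/-- The quadratic form `Y² - XZ`. -/
noncomputable def conicForm (k : Type*) [Field k] : QuadraticForm k (Fin 3 → k) :=
  QuadraticMap.proj 1 1 - QuadraticMap.proj 0 2

theorem conicForm_apply {k : Type*} [Field k] (d : Fin 3 → k) :
    conicForm k d = d 1 * d 1 - d 0 * d 2 := by
  simp [conicForm]

theorem exists_polar_conicForm_ne_zero {k : Type*} [Field k] {d : Fin 3 → k} (hd : d ≠ 0)
    (h : conicForm k d = 0) : ∃ e, QuadraticMap.polar (conicForm k) d e ≠ 0 := by
  by_contra! hc
  have h0 := hc ![1, 0, 0]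
  have h2 := hc ![0, 0, 1]
  simp [QuadraticMap.polar, conicForm_apply, vecHead, vecTail] at h h0 h2
  have e0 : d 0 = 0 := by linear_combination -h2
  have e2 : d 2 = 0 := by linear_combination -h0
  have e1 : d 1 = 0 := by simpa [e0] using h
  apply hd
  ext i
  fin_cases i <;> assumption

theorem IsQuadraticKernel.mulVec_veronese {k : Type*} [Field k] {A B : Matrix (Fin 3) (Fin 3) k}
    {u v t : Fin 3 → k} (h : IsQuadraticKernel A B u v t) (z w : k) :
    pencil A B z w *ᵥ ((of ![u, v, t])ᵀ *ᵥ veronese z w) = 0 := by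
  rw [← h.mulVec_pencil_eq_zero z w]
  congr 1
  ext i
  simp [veronese, mulVec, dotProduct, Fin.sum_univ_three]
  ring

theorem veronese_ne_zero {k : Type*} [Field k] {z w : k} (h : z ≠ 0 ∨ w ≠ 0) :
    veronese z w ≠ 0 := by
  intro h0
  have h1 := congrFun h0 0
  have h2 := congrFun h0 2
  simp [veronese] at h1 h2
  tauto

variable {S : Matrix (Fin 3) (Fin 3) k}

theorem PencilBasePointFree.mulVec_pencil_eq_zero_iff (H : PencilBasePointFree A B)
    (hS : Function.Injective S.mulVec) (hker : ∀ z w, pencil A B z w *ᵥ (S *ᵥ veronese z w) = 0)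
    {z w : k} (hzw : z ≠ 0 ∨ w ≠ 0) {c : Fin 3 → k} :
    pencil A B z w *ᵥ c = 0 ↔ ∃ l : k, c = S *ᵥ (l • veronese z w) := by
  constructor
  · intro h
    have h0 : S *ᵥ veronese z w ≠ 0 := fun h0 =>
      veronese_ne_zero hzw (hS (h0.trans (mulVec_zero S).symm))
    obtain ⟨l, hl⟩ := exists_smul_eq_of_cross_eq_zero h0
      (H.cross_eq_zero_of_mulVec_pencil hzw (hker z w) h)
    exact ⟨l, by rw [hl, mulVec_smul]⟩
  · rintro ⟨l, rfl⟩
    rw [mulVec_smul, mulVec_smul, hker, smul_zero]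

/-- The plane `W(p)`, in the coordinates in which the kernel of the pencil is the Veronese vector. -/
noncomputable def planeEquiv (hinj : Function.Injective (Fintype.linearCombination k p))
    (hS : Function.Injective S.mulVec) : (Fin 3 → k) ≃ₗ[k] spanW p :=
  (LinearEquiv.ofInjective (Fintype.linearCombination k p ∘ₗ S.mulVecLin)
    (hinj.comp hS)).trans (LinearEquiv.ofEq _ _ (by
      have : LinearMap.range S.mulVecLin = ⊤ :=
        LinearMap.range_eq_top.2 (LinearMap.injective_iff_surjective.1 hS)
      rw [LinearMap.range_comp, this, Submodule.map_top, Fintype.range_linearCombination, spanW]))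

theorem mk_linearCombination_mulVec_mem_segreY (H : PencilBasePointFree A B)
    (hp : ∀ i, p i = biForm (A.col i) (B.col i))
    (hS : Function.Injective S.mulVec) (hker : ∀ z w, pencil A B z w *ᵥ (S *ᵥ veronese z w) = 0)
    {d : Fin 3 → k} (hd : Fintype.linearCombination k p (S *ᵥ d) ≠ 0) :
    Projectivization.mk k _ hd ∈ segreY k ↔ conicForm k d = 0 := by
  have hd0 : d ≠ 0 := by
    rintro rfl
    simp at hd
  rw [mk_linearCombination_mem_segreY hp, conicForm_apply, ← exists_smul_veronese_iff hd0]
  refine exists_congr fun z => exists_congr fun w => and_congr_right fun hzw => ?_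
  rw [H.mulVec_pencil_eq_zero_iff hS hker hzw]
  exact exists_congr fun l => hS.eq_iff

theorem isSmoothConicIn_spanW (H : PencilBasePointFree A B)
    (hp : ∀ i, p i = biForm (A.col i) (B.col i))
    (hS : Function.Injective S.mulVec) (hker : ∀ z w, pencil A B z w *ᵥ (S *ᵥ veronese z w) = 0) :
    IsSmoothConicIn (spanW p) (planeW p ∩ segreY k) := by
  let F := planeEquiv (H.linearCombination_injective hp) hS
  refine ⟨by rw [← F.finrank_eq]; simp,
    (conicForm k).comp F.symm.toLinearMap, fun u hu hQ => ?_, ?_⟩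
  · obtain ⟨e, he⟩ := exists_polar_conicForm_ne_zero
      (fun h => hu (F.symm.map_eq_zero_iff.1 h)) hQ
    refine ⟨F e, ?_⟩
    simpa [QuadraticMap.polar] using he
  · ext P
    refine and_congr_right fun hP => ?_
    obtain ⟨c, hc, rfl⟩ := mem_planeW_iff.1 hP
    obtain ⟨d, rfl⟩ : ∃ d, S *ᵥ d = c :=
      LinearMap.injective_iff_surjective (f := S.mulVecLin).1 hS c
    rw [mk_linearCombination_mulVec_mem_segreY H hp hS hker, Projectivization.submodule_mk]
    constructor
    · intro h u hu
      obtain ⟨a, ha⟩ := Submodule.mem_span_singleton.1 hu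
      have : u = F (a • d) := by
        apply Subtype.ext
        rw [← ha, map_smul]
        rfl
      rw [this]
      simp [QuadraticMap.map_smul, h]
    · intro h
      simpa using h (F d) (Submodule.mem_span_singleton_self _)

theorem infinite_inter (H : PencilBasePointFree A B)
    (hp : ∀ i, p i = biForm (A.col i) (B.col i))
    (hS : Function.Injective S.mulVec) (hker : ∀ z w, pencil A B z w *ᵥ (S *ᵥ veronese z w) = 0) :
    (planeW p ∩ segreY k).Infinite := by
  have hinj := (H.linearCombination_injective hp).comp hS
  have h0 (a : k) : Fintype.linearCombination k p (S *ᵥ veronese 1 a) ≠ 0 := fun h =>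
    veronese_ne_zero (z := 1) (w := a) (by simp) (hinj (by simp [h]))
  refine Set.infinite_of_injective_forall_mem
    (f := fun a : k => Projectivization.mk k _ (h0 a)) (fun a b hab => ?_) fun a =>
      ⟨mem_planeW_iff.2 ⟨_, h0 a, rfl⟩,
        (mk_linearCombination_mulVec_mem_segreY H hp hS hker (h0 a)).2 ?_⟩
  · obtain ⟨l, hl⟩ := (Projectivization.mk_eq_mk_iff' _ _ _ _ _).1 hab
    rw [← map_smul, ← mulVec_smul] at hl
    have e := hinj hl
    have e0 := congrFun e 0
    have e1 := congrFun e 1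
    simp [veronese] at e0 e1
    simpa [e0] using e1.symm
  · simp [conicForm_apply, veronese]
    ring

/-- The syzygy `S (z², zw, w²)`. -/
noncomputable def veroneseSyzygy {k : Type*} [Field k] (S : Matrix (Fin 3) (Fin 3) k) :
    Fin 3 → BiRing k :=
  S.map MvPolynomial.C *ᵥ
    ![MvPolynomial.X 2 * MvPolynomial.X 2, MvPolynomial.X 2 * MvPolynomial.X 3,
      MvPolynomial.X 3 * MvPolynomial.X 3]

theorem map_C_mulVec_mem {k : Type*} [Field k] (S : Matrix (Fin 3) (Fin 3) k)
    {τ : Fin 3 → BiRing k} {m n : ℤ} (h : ∀ i, τ i ∈ biPiece k m n) (i : Fin 3) :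
    (S.map MvPolynomial.C *ᵥ τ) i ∈ biPiece k m n :=
  Submodule.sum_mem (biPiece k m n) fun j _ =>
    MvPolynomial.IsWeightedHomogeneous.C_mul (h j) (S i j)

theorem eval_map_C_mulVec {k : Type*} [Field k] (S : Matrix (Fin 3) (Fin 3) k)
    (τ : Fin 3 → BiRing k) (s : Fin 4 → k) (i : Fin 3) :
    MvPolynomial.eval s ((S.map MvPolynomial.C *ᵥ τ) i) =
      (S *ᵥ fun i => MvPolynomial.eval s (τ i)) i := by
  simp [mulVec, dotProduct]

theorem eval_veroneseSyzygy {k : Type*} [Field k] (S : Matrix (Fin 3) (Fin 3) k) (s : Fin 4 → k) :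
    (fun i => MvPolynomial.eval s (veroneseSyzygy S i)) = S *ᵥ veronese (s 2) (s 3) := by
  funext i
  rw [veroneseSyzygy, eval_map_C_mulVec]
  congr 2
  ext i
  fin_cases i <;> simp [veronese] <;> ring

theorem veroneseSyzygy_mem (hp : ∀ i, p i = biForm (A.col i) (B.col i))
    (hker : ∀ z w, pencil A B z w *ᵥ (S *ᵥ veronese z w) = 0) :
    veroneseSyzygy S ∈ biSyzPiece p 2 3 := by
  refine (mem_biSyzPiece_iff hp (by norm_num)).2 ⟨map_C_mulVec_mem S fun i => ?_, fun s => ?_⟩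
  · fin_cases i <;> exact X_mul_X_mem_biPiece (by decide) (by decide)
  · rw [eval_veroneseSyzygy, hker]

theorem veroneseSyzygy_smul_mem (hp : ∀ i, p i = biForm (A.col i) (B.col i))
    (hker : ∀ z w, pencil A B z w *ᵥ (S *ᵥ veronese z w) = 0) {n : ℤ} (hn : 3 ≤ n) {h : BiRing k}
    (hh : h ∈ biPiece k 0 (n - 3)) : h • veroneseSyzygy S ∈ biSyzPiece p 2 n := by
  have hσ := (mem_biSyzPiece_iff hp (by norm_num)).1 (veroneseSyzygy_mem hp hker)
  refine (mem_biSyzPiece_iff hp (by omega)).2 ⟨fun i => ?_, fun s => ?_⟩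
  · have := MvPolynomial.IsWeightedHomogeneous.mul hh (hσ.1 i)
    rwa [Prod.mk_add_mk, zero_add, show n - 3 + (3 - 1) = n - 1 by ring] at this
  · have : (fun i => MvPolynomial.eval s ((h • veroneseSyzygy S) i)) =
        MvPolynomial.eval s h • fun i => MvPolynomial.eval s (veroneseSyzygy S i) := by
      ext i; simp
    rw [this, mulVec_smul, hσ.2, smul_zero]

theorem veroneseSyzygy_ne_zero {k : Type*} [Field k] {S : Matrix (Fin 3) (Fin 3) k}
    (hS : Function.Injective S.mulVec) : veroneseSyzygy S ≠ 0 := by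
  intro h
  have h1 := eval_veroneseSyzygy S ![0, 0, 1, 0]
  refine veronese_ne_zero (k := k) (z := 1) (w := 0) (by simp) (hS ?_)
  rw [mulVec_zero]
  refine Eq.trans h1.symm ?_
  simp [h]
  rfl

/-- In the coordinates given by `S`, the values of a syzygy are proportional to `(z², zw, w²)`, so
that its entries `a, b, c` satisfy `w a = z b` and `w b = z c`; hence they are `h z²`, `h zw` and
`h w²`. -/
theorem exists_eq_smul_veroneseSyzygy (H : PencilBasePointFree A B)
    (hp : ∀ i, p i = biForm (A.col i) (B.col i)) (hS : Function.Injective S.mulVec)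
    (hker : ∀ z w, pencil A B z w *ᵥ (S *ᵥ veronese z w) = 0) {n : ℤ} (hn : 3 ≤ n)
    {τ : Fin 3 → BiRing k} (hτ : τ ∈ biSyzPiece p 2 n) :
    ∃ h ∈ biPiece k 0 (n - 3), τ = h • veroneseSyzygy S := by
  rw [mem_biSyzPiece_iff hp (by omega)] at hτ
  obtain ⟨hmem, hval⟩ := hτ
  have hSu : IsUnit S.det := (isUnit_iff_isUnit_det S).1 (mulVec_injective_iff_isUnit.1 hS)
  have hmap : (S.map MvPolynomial.C * S⁻¹.map MvPolynomial.C :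
      Matrix (Fin 3) (Fin 3) (BiRing k)) = 1 := by
    rw [← Matrix.map_mul, mul_nonsing_inv _ hSu, Matrix.map_one _ (map_zero _) (map_one _)]
  obtain ⟨τ', hτ'⟩ : ∃ τ', τ' = (S⁻¹.map MvPolynomial.C *ᵥ τ : Fin 3 → BiRing k) := ⟨_, rfl⟩
  have hback : τ = S.map MvPolynomial.C *ᵥ τ' := by rw [hτ', mulVec_mulVec, hmap, one_mulVec]
  have hmem' (i : Fin 3) : τ' i ∈ biPiece k 0 (n - 1) := hτ' ▸ map_C_mulVec_mem _ hmem i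
  have hprop (s : Fin 4 → k) (hs : s 2 ≠ 0 ∨ s 3 ≠ 0) :
      ∃ l : k, ∀ i, MvPolynomial.eval s (τ' i) = l * veronese (s 2) (s 3) i := by
    obtain ⟨l, hl⟩ := (H.mulVec_pencil_eq_zero_iff hS hker hs).1 (hval s)
    refine ⟨l, fun i => ?_⟩
    rw [hτ', eval_map_C_mulVec, hl, mulVec_mulVec, nonsing_inv_mul _ hSu, one_mulVec]
    rfl
  have hrel (i j : Fin 3)
      (hij : ∀ z w : k, w * veronese z w i = z * veronese z w j) :
      (MvPolynomial.X 3 * τ' i : BiRing k) = MvPolynomial.X 2 * τ' j := by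
    refine MvPolynomial.funext fun s => ?_
    simp only [map_mul, MvPolynomial.eval_X]
    by_cases hs : s 2 ≠ 0 ∨ s 3 ≠ 0
    · obtain ⟨l, hl⟩ := hprop s hs
      rw [hl, hl]
      linear_combination l * hij (s 2) (s 3)
    · push Not at hs
      rw [hs.1, hs.2, zero_mul, zero_mul]
  have h01 := hrel 0 1 fun z w => by simp [veronese]; ring
  have h12 := hrel 1 2 fun z w => by simp [veronese]; ring
  have hX2 : (MvPolynomial.X 2 : BiRing k) ≠ 0 := MvPolynomial.X_ne_zero 2
  have hX : Prime (MvPolynomial.X 2 : BiRing k) := MvPolynomial.X_prime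
  have hndvd : ¬ (MvPolynomial.X 2 : BiRing k) ∣ MvPolynomial.X 3 := by
    rw [MvPolynomial.X_dvd_X]
    decide
  obtain ⟨f, hf⟩ := (hX.dvd_or_dvd ⟨_, h01⟩).resolve_left hndvd
  have hf1 : τ' 1 = MvPolynomial.X 3 * f := by
    rw [hf] at h01
    exact mul_left_cancel₀ hX2 (by linear_combination -h01)
  rw [hf1] at h12
  obtain ⟨h, hh⟩ := (hX.dvd_or_dvd
    ((hX.dvd_or_dvd ⟨_, h12⟩).resolve_left hndvd)).resolve_left hndvd
  have hf2 : τ' 2 = MvPolynomial.X 3 * (MvPolynomial.X 3 * h) := by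
    rw [hh] at h12
    exact mul_left_cancel₀ hX2 (by linear_combination -h12)
  refine ⟨h, ?_, ?_⟩
  · have h0 := hmem' 0
    rw [hf, hh] at h0
    refine mem_biPiece_of_X_mul (mem_biPiece_of_X_mul ?_)
    rwa [show n - 3 + 1 + 1 = n - 1 by ring]
  · rw [hback, veroneseSyzygy, ← mulVec_smul]
    congr 1
    ext1 i
    fin_cases i
    · simp [hf, hh]; ring
    · simp [hf1, hh]; ring
    · simp [hf2]; ring

theorem smul_left_injective_of_ne_zero {k : Type*} [Field k] {σ : Fin 3 → BiRing k}
    (hσ : σ ≠ 0) {h h' : BiRing k}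
    (e : h • σ = h' • σ) : h = h' := by
  obtain ⟨i, hi⟩ := Function.ne_iff.1 hσ
  exact mul_right_cancel₀ hi (congrFun e i)

theorem finrank_biSyzPiece (H : PencilBasePointFree A B)
    (hp : ∀ i, p i = biForm (A.col i) (B.col i)) (hS : Function.Injective S.mulVec)
    (hker : ∀ z w, pencil A B z w *ᵥ (S *ᵥ veronese z w) = 0) {n : ℤ} (hn : 3 ≤ n) :
    (Module.finrank k (biSyzPiece p 2 n) : ℤ) = n - 2 := by
  let φ : biPiece k 0 (n - 3) →ₗ[k] biSyzPiece p 2 n :=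
    { toFun h := ⟨(h : BiRing k) • veroneseSyzygy S, veroneseSyzygy_smul_mem hp hker hn h.2⟩
      map_add' h h' := Subtype.ext (add_smul _ _ _)
      map_smul' a h := Subtype.ext (smul_assoc _ _ _) }
  have hφ : Function.Bijective φ := by
    refine ⟨fun h h' e => Subtype.ext (smul_left_injective_of_ne_zero
      (veroneseSyzygy_ne_zero hS) (congrArg Subtype.val e)), fun τ => ?_⟩
    obtain ⟨h, hh, e⟩ := exists_eq_smul_veroneseSyzygy H hp hS hker hn τ.2
    exact ⟨⟨h, hh⟩, Subtype.ext e.symm⟩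
  rw [← (LinearEquiv.ofBijective φ hφ).finrank_eq]
  obtain ⟨m, hm⟩ := Int.eq_ofNat_of_zero_le (show 0 ≤ n - 3 by omega)
  rw [hm]
  have := finrank_biPiece (k := k) 0 m
  rw [show ((0 : ℕ) : ℤ) = 0 from rfl] at this
  rw [this]
  push_cast
  omega

end Closed

theorem theorem4p1 {k : Type*} [Field k] [IsAlgClosed k] (p : Fin 3 → biPiece k 2 1)
    (hp : NoCommonZero p) :
    ((planeW p ∩ segreY k).Finite → ∀ n : ℤ, 3 ≤ n → biSyzPiece p 2 n = ⊥) ∧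
    ((planeW p ∩ segreY k).Infinite →
      IsSmoothConicIn (spanW p) (planeW p ∩ segreY k) ∧
      (∀ n : ℤ, 3 ≤ n → (Module.finrank k (biSyzPiece p 2 n) : ℤ) = n - 2) ∧
      ∃ σ ∈ biSyzPiece p 2 3, ∀ n : ℤ, 3 ≤ n → ∀ τ ∈ biSyzPiece p 2 n,
        ∃! h : BiRing k, h ∈ biPiece k 0 (n - 3) ∧ τ = h • σ) := by
  obtain ⟨A, B, hAB⟩ := exists_matrix_eq_biForm p
  have H := pencilBasePointFree hAB hp
  by_cases hdet : ∀ z w : k, (pencil A B z w).det = 0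
  · obtain ⟨u, v, t, hker, hli⟩ := H.exists_isQuadraticKernel hdet
    have hS := hli.matrix_injective
    have hker' := hker.mulVec_veronese
    refine ⟨fun hfin => absurd hfin (infinite_inter H hAB hS hker'), fun _ =>
      ⟨isSmoothConicIn_spanW H hAB hS hker', fun n hn => finrank_biSyzPiece H hAB hS hker' hn,
        _, veroneseSyzygy_mem hAB hker', fun n hn τ hτ => ?_⟩⟩
    obtain ⟨h, hh, e⟩ := exists_eq_smul_veroneseSyzygy H hAB hS hker' hn hτ
    exact ⟨h, ⟨hh, e⟩, fun h' he => smul_left_injective_of_ne_zero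
      (veroneseSyzygy_ne_zero hS) (he.2.symm.trans e)⟩
  · push Not at hdet
    obtain ⟨z, w, hzw⟩ := hdet
    exact ⟨fun _ n hn => biSyzPiece_eq_bot hAB hzw (by omega),
      fun hinf => absurd (H.finite_inter hAB hzw) hinf⟩
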